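/- **Preferences and popularity.** In a bipartite graph $G=(A\cup B,E)$ in which every node ranks its neighbours in a strict order (a strict preference list), a node $u$ prefers a matching $M$ to a matching $N$ if $u$ is matched in $M$ and unmatched in $N$, or if $u$ is matched in both and prefers its partner in $M$ to its partner in $N$. A matching $M$ is popular if for every matching $N$ of $G$ the number of nodes that prefer $N$ to $M$ is at most the number of nodes that prefer $M$ to $N$. **Formulas.** Let $\varphi$ be a 3CNF formula without negations, with variables $X_1,\dots,X_{n_0}$ and finitely many clauses $c=X_i\vee X_j\vee X_k$ (the order of the three variables in each clause is fixed; repetitions are allowed). The formula is 1-in-3 satisfiable if some truth assignment makes, in every clause, exactly one of its three literal occurrences true. **The instance $G=(A\cup B,E)$.** The nodes are $$A=\{a_0,z'\}\cup\bigcup_i\{x_i,x'_i\}\cup\bigcup_c\big(\{a^c_t:1\le t\le 6\}\cup\{p^c_t:0\le t\le 8\}\cup\{s^c_t:0\le t\le 3\}\big),$$ $$B=\{b_0,z\}\cup\bigcup_i\{y_i,y'_i\}\cup\bigcup_c\big(\{b^c_t:1\le t\le 6\}\cup\{q^c_t:0\le t\le 8\}\cup\{t^c_t:0\le t\le 3\}\big).$$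 Every node is adjacent exactly to the nodes on its preference list. The lists are as follows; a set in a list stands for its elements in an arbitrary order (chosen separately for each list), and the superscript $c$ is dropped in the lists of clause nodes. * $a_0: b_0\succ z$ and $b_0: a_0\succ z'$. * $z:\{x_i\}_i\succ\{p^c_1,p^c_4,p^c_7\}_c\succ a_0\succ\{a^c_1,a^c_3,a^c_5\}_c$ and $z':\{y_i\}_i\succ\{q^c_0,q^c_3,q^c_6\}_c\succ b_0\succ\{b^c_1,b^c_3,b^c_5\}_c$. * For each variable $X_r$: $x_r: y_r\succ y'_r\succ z\succ T$; $\;y_r: x_r\succ x'_r\succ z'\succ T$; $\;x'_r: y_r\succ y'_r\succ T$; $\;y'_r: x_r\succ x'_r\succ T$. In each case $T$ is the set of all other nodes whose list below contains the node in question. * For each clause $c=X_i\vee X_j\vee X_k$ and $g=0,1,2$, let $(u,v)=(j,k),(k,i),(i,j)$ respectively. - With $a=a_{2g+1}$, $\bar a=a_{2g+2}$, $b=b_{2g+1}$, $\bar b=b_{2g+2}$: $\;a: b\succ y'_u\succ \bar b\succ z$; $\;b:\bar a\succ x'_v\succ a\succ z'$; $\;\bar a:\bar b\succ b$; $\;\bar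 b: a\succ\bar a$. - $p_{3g}: q_{3g}\succ q_{3g+2}$; $\;q_{3g}: p_{3g}\succ p_{3g+2}\succ z'$, followed by $s_0$ if $g\in\{0,1\}$; $\;p_{3g+1}: q_{3g+1}\succ q_{3g+2}\succ z$, followed by $t_0$ if $g\in\{1,2\}$; $\;q_{3g+1}: p_{3g+1}\succ p_{3g+2}$; $\;p_{3g+2}: q_{3g}\succ y_u\succ q_{3g+1}\succ q_{3g+2}\succ\{t^{d}_0: d\text{ a clause}\}$; $\;q_{3g+2}: p_{3g+1}\succ x_v\succ p_{3g}\succ p_{3g+2}\succ\{s^{d}_0: d\text{ a clause}\}$. * For each clause $c$: $s_0: t_1\succ q_0\succ t_2\succ q_3\succ t_3\succ\{y'_r\}_r\cup\{q^d_2,q^d_5,q^d_8\}_d$; $\;t_0: s_3\succ p_7\succ s_2\succ p_4\succ s_1\succ\{x'_r\}_r\cup\{p^d_2,p^d_5,p^d_8\}_d$; and for $r=1,2,3$: $\;s_r: t_r\succ t_0$ and $t_r: s_r\succ s_0$. Here $d$ ranges over all clauses. **Theorem.** For every such formula $\varphi$ and every choice of the orders left open above, $G$ admits a popular matching that matches all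 nodes except $z$ and $z'$ (which it leaves unmatched) if and only if $\varphi$ is 1-in-3 satisfiable. -/

import Mathlib

namespace PopularMatching

/-- A bipartite instance `G = (A ∪ B, E)` with strict preference lists: `Prefers u v w` means that
`u` ranks its neighbour `v` strictly above its neighbour `w`. -/
structure BipartiteInstance (V : Type) where
  A : Set V
  B : Set V
  graph : SimpleGraph V
  Prefers : V → V → V → Prop
  union_eq : A ∪ B = Set.univ
  bipartite : graph.IsBipartiteWith A B
  strict : ∀ u, IsStrictTotalOrder (graph.neighborSet u) (fun v w => Prefers u v w)

namespace BipartiteInstance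

variable {V : Type} (I : BipartiteInstance V)

/-- Node `u` prefers the matching `M` to the matching `N`: either `u` is matched in `M` and
unmatched in `N`, or it is matched in both and prefers its partner in `M`. -/
def PrefersMatching (u : V) (M N : I.graph.Subgraph) : Prop :=
  (u ∈ M.verts ∧ u ∉ N.verts) ∨ ∃ v w, M.Adj u v ∧ N.Adj u w ∧ I.Prefers u v w

/-- The number of nodes that prefer `M` to `N` (used for finite `V` only). -/
noncomputable def votes (M N : I.graph.Subgraph) : ℕ :=
  {u | I.PrefersMatching u M N}.ncard

/-- `M` is a popular matching: no matching wins a majority vote against it. -/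
def IsPopularMatching (M : I.graph.Subgraph) : Prop :=
  M.IsMatching ∧ ∀ N : I.graph.Subgraph, N.IsMatching → I.votes N M ≤ I.votes M N

end BipartiteInstance

/-- A 3CNF formula without negations. Clause `c` is `X_i ∨ X_j ∨ X_k` with `i = clause c 0`,
`j = clause c 1`, `k = clause c 2`; repetitions are allowed. -/
structure Formula where
  numVars : ℕ
  numClauses : ℕ
  clause : Fin numClauses → Fin 3 → Fin numVars

/-- Some assignment makes exactly one of the three positions of every clause true. -/
def Formula.OneInThreeSat (φ : Formula) : Prop :=
  ∃ τ : Fin φ.numVars → Bool, ∀ c, ∃! r : Fin 3, τ (φ.clause c r) = true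

/-- The nodes of the gadget instance for `n` variables and `m` clauses. In level 0 and level 2
there are three gadgets `g = 0, 1, 2` for every clause `c`:
* level 0: `a1 c g`, `a2 c g`, `b1 c g`, `b2 c g` are
  `a^c_{2g+1}`, `a^c_{2g+2}`, `b^c_{2g+1}`, `b^c_{2g+2}`;
* level 1: `x i`, `xPrime i`, `y i`, `yPrime i` are `x_i`, `x'_i`, `y_i`, `y'_i`;
* level 2: `p0 c g`, `p1 c g`, `p2 c g` are `p^c_{3g}`, `p^c_{3g+1}`, `p^c_{3g+2}`,
  and likewise for `q`;
* level 3: `s0 c` and `t0 c` are `s^c_0` and `t^c_0`, while `s c r` and `t c r` are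
  `s^c_{r+1}` and `t^c_{r+1}` for `r = 0, 1, 2`. -/
inductive Node (n m : ℕ) : Type
  | a0 | b0 | z | zPrime
  | a1 (c : Fin m) (g : Fin 3)
  | a2 (c : Fin m) (g : Fin 3)
  | b1 (c : Fin m) (g : Fin 3)
  | b2 (c : Fin m) (g : Fin 3)
  | x (i : Fin n)
  | xPrime (i : Fin n)
  | y (i : Fin n)
  | yPrime (i : Fin n)
  | p0 (c : Fin m) (g : Fin 3)
  | p1 (c : Fin m) (g : Fin 3)
  | p2 (c : Fin m) (g : Fin 3)
  | q0 (c : Fin m) (g : Fin 3)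
  | q1 (c : Fin m) (g : Fin 3)
  | q2 (c : Fin m) (g : Fin 3)
  | s0 (c : Fin m)
  | t0 (c : Fin m)
  | s (c : Fin m) (r : Fin 3)
  | t (c : Fin m) (r : Fin 3)
  deriving DecidableEq, Fintype

namespace Formula

open Node

/-- The type of nodes of the instance built from `φ`. -/
abbrev GNode (φ : Formula) : Type := Node φ.numVars φ.numClauses

/-- The preference list of each node, as a list of blocks of neighbours: every member of an earlier
block is preferred to every member of a later one, and the order inside a block is arbitrary.
In gadget `g` of clause `c`, the variables at positions `g + 1` and `g + 2` (modulo 3) occur: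
`(j, k)` for `g = 0`, `(k, i)` for `g = 1` and `(i, j)` for `g = 2`. -/
def prefBlocks (φ : Formula) : φ.GNode → List (Set φ.GNode)
  | a0 => [{b0}, {z}]
  | b0 => [{a0}, {zPrime}]
  | z => [{v | ∃ i, v = x i}, {v | ∃ c g, v = p1 c g}, {a0}, {v | ∃ c g, v = a1 c g}]
  | zPrime => [{v | ∃ i, v = y i}, {v | ∃ c g, v = q0 c g}, {b0}, {v | ∃ c g, v = b1 c g}]
  -- level 0
  | a1 c g => [{b1 c g}, {yPrime (φ.clause c (g + 1))}, {b2 c g}, {z}]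
  | b1 c g => [{a2 c g}, {xPrime (φ.clause c (g + 2))}, {a1 c g}, {zPrime}]
  | a2 c g => [{b2 c g}, {b1 c g}]
  | b2 c g => [{a1 c g}, {a2 c g}]
  -- level 1
  | x i => [{y i}, {yPrime i}, {z}, {v | ∃ c g, φ.clause c (g + 2) = i ∧ v = q2 c g}]
  | y i => [{x i}, {xPrime i}, {zPrime}, {v | ∃ c g, φ.clause c (g + 1) = i ∧ v = p2 c g}]
  | xPrime i => [{y i}, {yPrime i},
      {v | (∃ c g, φ.clause c (g + 2) = i ∧ v = b1 c g) ∨ ∃ c, v = t0 c}]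
  | yPrime i => [{x i}, {xPrime i},
      {v | (∃ c g, φ.clause c (g + 1) = i ∧ v = a1 c g) ∨ ∃ c, v = s0 c}]
  -- level 2
  | p0 c g => [{q0 c g}, {q2 c g}]
  | q0 c g => [{p0 c g}, {p2 c g}, {zPrime}, if g = 2 then ∅ else {s0 c}]
  | p1 c g => [{q1 c g}, {q2 c g}, {z}, if g = 0 then ∅ else {t0 c}]
  | q1 c g => [{p1 c g}, {p2 c g}]
  | p2 c g => [{q0 c g}, {y (φ.clause c (g + 1))}, {q1 c g}, {q2 c g}, {v | ∃ d, v = t0 d}]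
  | q2 c g => [{p1 c g}, {x (φ.clause c (g + 2))}, {p0 c g}, {p2 c g}, {v | ∃ d, v = s0 d}]
  -- level 3
  | s0 c => [{t c 0}, {q0 c 0}, {t c 1}, {q0 c 1}, {t c 2},
      {v | (∃ i, v = yPrime i) ∨ ∃ d g, v = q2 d g}]
  | t0 c => [{s c 2}, {p1 c 2}, {s c 1}, {p1 c 1}, {s c 0},
      {v | (∃ i, v = xPrime i) ∨ ∃ d g, v = p2 d g}]
  | s c r => [{t c r}, {t0 c}]
  | t c r => [{s c r}, {s0 c}]

/-- The side `A` of the bipartition. -/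
def sideA (φ : Formula) : Set φ.GNode :=
  {v | v = a0 ∨ v = zPrime ∨ (∃ c g, v = a1 c g ∨ v = a2 c g) ∨ (∃ i, v = x i ∨ v = xPrime i) ∨
    (∃ c g, v = p0 c g ∨ v = p1 c g ∨ v = p2 c g) ∨ (∃ c, v = s0 c) ∨ ∃ c r, v = s c r}

/-- The side `B` of the bipartition. -/
def sideB (φ : Formula) : Set φ.GNode :=
  {v | v = b0 ∨ v = z ∨ (∃ c g, v = b1 c g ∨ v = b2 c g) ∨ (∃ i, v = y i ∨ v = yPrime i) ∨
    (∃ c g, v = q0 c g ∨ v = q1 c g ∨ v = q2 c g) ∨ (∃ c, v = t0 c) ∨ ∃ c r, v = t c r}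

/-- `v` occurs on the preference list of `u`. -/
def Listed (φ : Formula) (u v : φ.GNode) : Prop := ∃ S ∈ φ.prefBlocks u, v ∈ S

set_option maxHeartbeats 1000000 in
theorem listed_symm (φ : Formula) {u v : φ.GNode} (h : φ.Listed u v) : φ.Listed v u := by
  simp only [Listed] at h ⊢
  cases u <;> cases v <;> simp [prefBlocks] at h <;> simp [prefBlocks] <;> grind

set_option maxHeartbeats 1000000 in
theorem listed_sides (φ : Formula) {u v : φ.GNode} (h : φ.Listed u v) :
    (u ∈ φ.sideA ∧ v ∈ φ.sideB) ∨ (u ∈ φ.sideB ∧ v ∈ φ.sideA) := by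
  simp only [Listed] at h
  cases u <;> simp only [prefBlocks, List.mem_cons, List.not_mem_nil, or_false,
    exists_eq_or_imp, exists_eq_left, Set.mem_singleton_iff, Set.mem_ofPred_eq] at h <;>
    simp only [sideA, sideB, Set.mem_ofPred_eq] <;> grind

theorem sides_union (φ : Formula) : φ.sideA ∪ φ.sideB = Set.univ := by
  ext v
  cases v <;> simp [sideA, sideB]

theorem sides_disjoint (φ : Formula) : Disjoint φ.sideA φ.sideB := by
  rw [Set.disjoint_left]
  intro v
  cases v <;> simp [sideA, sideB]

/-- The gadget graph: each node is adjacent to the nodes on its preference list. -/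
def gadgetGraph (φ : Formula) : SimpleGraph φ.GNode where
  Adj := φ.Listed
  symm := ⟨fun _ _ h => φ.listed_symm h⟩
  loopless := ⟨fun u h => by
    have hd := Set.disjoint_left.1 φ.sides_disjoint
    rcases φ.listed_sides h with h | h
    · exact hd h.1 h.2
    · exact hd h.2 h.1⟩

open Classical in
/-- The index of the first block of the preference list of `u` that contains `v`. -/
noncomputable def blockIndex (φ : Formula) (u v : φ.GNode) : ℕ :=
  (φ.prefBlocks u).findIdx (fun S => decide (v ∈ S))

/-- The preferences of the nodes; `tie u` orders the neighbours of `u` inside each block. -/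
def GadgetPrefers (φ : Formula) (tie : φ.GNode → φ.GNode → ℕ) (u v w : φ.GNode) : Prop :=
  φ.blockIndex u v < φ.blockIndex u w ∨
    (φ.blockIndex u v = φ.blockIndex u w ∧ tie u v < tie u w)

/-- The bipartite instance built from `φ`, where the orders that the construction leaves open are
given by `tie`. -/
def gadgetInstance (φ : Formula) (tie : φ.GNode → φ.GNode → ℕ)
    (htie : ∀ u, Function.Injective (tie u)) : BipartiteInstance φ.GNode where
  A := φ.sideA
  B := φ.sideB
  graph := φ.gadgetGraph
  Prefers := φ.GadgetPrefers tie
  union_eq := φ.sides_union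
  bipartite := ⟨φ.sides_disjoint, fun _ _ h => φ.listed_sides h⟩
  strict u :=
    { trichotomous := by
        intro v w hvw hwv
        apply Subtype.ext
        apply htie u
        simp only [GadgetPrefers] at hvw hwv
        omega
      irrefl := by
        intro v h
        simp only [GadgetPrefers] at h
        omega
      trans := by
        intro v w r h1 h2
        simp only [GadgetPrefers] at h1 h2 ⊢
        omega }

end Formula

end PopularMatching

/-! Popularity of `M` says that a maximum-weight matching problem, in which an edge weighs the sum
of its ends' votes against `M`, has optimum at most 0. By linear programming duality this holds
exactly when the nodes carry labels of nonpositive total that dominate the votes on every edge and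
on every node left alone (`sum_vote_nonpos`, `exists_certificate`); such labels are tight on every
matching that does not lose to `M` (`certificate_tight`).

From a satisfying assignment, `pairing` and an explicit labelling are written down, and domination
is a finite check per type of edge (`score_add_score_le`).

Conversely, let `M` be popular, missing only `z` and `z'`, with doubled labels in [-2, 2]. The
stable matching S (the `pairing` with no true variable) is popular too, so the labels are tight on
it. Since `M` covers `s0` and `t0` while S misses them, both get label -2. Reading "x_i is matched
to y'_i" as "X_i is true", three local facts finish the proof. The labels -2 at level 3 force
positive labels in two of the three level 2 gadgets of a clause (`exists_pos_of_ne`). A positive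
label in a level 2 gadget forces one of its two literals to be true (`exists_true_of_pos`). A level
0 gadget forbids both of its literals from being true (`not_both_true`). The gadgets of a clause
range over the pairs of its positions, so exactly one position is true. Every comparison used is
settled between blocks, so the orders left open do not matter. -/

namespace PopularMatching

/-! ### Integral duality for weighted permutations -/

/-- Egerváry duality for a reflexive relation: if every permutation along `R` has nonpositive
weight, then there are integral potentials of nonpositive total dominating the weights. -/
theorem exists_potentials {V : Type*} [Fintype V] (R : V → V → Prop) (w : V → V → ℤ)
    (hR : ∀ u, R u u)
    (h : ∀ σ : Equiv.Perm V, (∀ u, R u (σ u)) → ∑ u, w u (σ u) ≤ 0) :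
    ∃ f g : V → ℤ, (∀ u v, R u v → w u v ≤ f u + g v) ∧ ∑ u, f u + ∑ u, g u ≤ 0 := by
  classical
  -- Subtracting the diagonal weight makes the total of dominating potentials a natural number, so a
  -- minimal choice exists.
  let P : ℕ → Prop := fun k => ∃ f g : V → ℤ, (∀ u v, R u v → w u v ≤ f u + g v) ∧
    (k : ℤ) = ∑ u, f u + ∑ u, g u - ∑ u, w u u
  have lower : ∀ f g : V → ℤ, (∀ u v, R u v → w u v ≤ f u + g v) →
      0 ≤ ∑ u, f u + ∑ u, g u - ∑ u, w u u := by
    intro f g hfg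
    rw [← Finset.sum_add_distrib, ← Finset.sum_sub_distrib]
    exact Finset.sum_nonneg fun u _ => by linarith [hfg u u (hR u)]
  have hP : ∃ k, P k := by
    let f : V → ℤ := fun u => ∑ v, |w u v|
    have hf : ∀ u v, R u v → w u v ≤ f u + 0 := fun u v _ => by
      have := Finset.single_le_sum (f := fun v => |w u v|) (fun i _ => abs_nonneg _)
        (Finset.mem_univ v)
      have h2 := le_abs_self (w u v)
      simp only [f]
      linarith
    exact ⟨_, f, fun _ => 0, hf, Int.toNat_of_nonneg (lower f (fun _ => 0) hf)⟩
  obtain ⟨f, g, hfg, hk⟩ := Nat.find_spec hP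
  refine ⟨f, g, hfg, ?_⟩
  let T : V → Finset V := fun u => Finset.univ.filter fun v => R u v ∧ w u v = f u + g v
  -- Hall's condition for the tight pairs: if S had too few tight neighbours, lowering f by 1 on S
  -- and raising g by 1 on those neighbours would still dominate, because integral slack is at least
  -- 1, and would decrease the total.
  have hall : ∀ S : Finset V, S.card ≤ (S.biUnion T).card := by
    intro S
    by_contra! hS
    let f' : V → ℤ := fun u => f u - if u ∈ S then 1 else 0
    let g' : V → ℤ := fun v => g v + if v ∈ S.biUnion T then 1 else 0
    have hfg' : ∀ u v, R u v → w u v ≤ f' u + g' v := by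
      intro u v huv
      have h1 := hfg u v huv
      by_cases hu : u ∈ S
      · by_cases hv : v ∈ S.biUnion T
        · simp only [f', g', hu, hv, if_true]
          linarith
        · have hne : w u v ≠ f u + g v := fun he =>
            hv (Finset.mem_biUnion.2 ⟨u, hu, by simp [T, huv, he]⟩)
          simp only [f', g', hu, hv, if_true, if_false]
          omega
      · simp only [f', g', hu, if_false]
        split_ifs <;> linarith
    have hsum : ∑ u, f' u + ∑ u, g' u =
        ∑ u, f u + ∑ u, g u - S.card + (S.biUnion T).card := by
      simp only [f', g', Finset.sum_sub_distrib, Finset.sum_add_distrib, Finset.sum_boole,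
        Finset.filter_mem_eq_inter, Finset.univ_inter]
      ring
    have hl := lower f' g' hfg'
    refine Nat.find_min hP (m := (∑ u, f' u + ∑ u, g' u - ∑ u, w u u).toNat) ?_
      ⟨f', g', hfg', Int.toNat_of_nonneg hl⟩
    omega
  obtain ⟨σ, hσ, hT⟩ := (Finset.all_card_le_biUnion_card_iff_exists_injective T).1 hall
  let e : Equiv.Perm V := Equiv.ofBijective σ (Finite.injective_iff_bijective.1 hσ)
  have he : ∀ u, R u (e u) ∧ w u (e u) = f u + g (e u) := fun u => (Finset.mem_filter.1 (hT u)).2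
  have := h e fun u => (he u).1
  rw [Finset.sum_congr rfl fun u _ => (he u).2, Finset.sum_add_distrib, Equiv.sum_comp e g] at this
  exact this

/-! ### Popularity and its dual certificates -/

namespace BipartiteInstance

variable {V : Type} (I : BipartiteInstance V)

open Classical in
/-- The vote of `u` for `v` against `w`, where `u` itself stands for being unmatched. -/
noncomputable def vote (u v w : V) : ℤ :=
  if v = w then 0 else if w = u then 1 else if v = u then -1 else if I.Prefers u v w then 1 else -1

/-- A matching given as an involution whose fixed points are the unmatched nodes. -/
structure IsPairing (ν : V → V) : Prop where
  apply_apply : ∀ u, ν (ν u) = u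
  adj : ∀ u, ν u ≠ u → I.graph.Adj u (ν u)

/-- The subgraph `M` has the matched pairs of `ν` as edges and their ends as vertices. -/
structure Represents (M : I.graph.Subgraph) (ν : V → V) : Prop where
  adj_iff : ∀ u v, M.Adj u v ↔ ν u = v ∧ u ≠ v
  mem_verts_iff : ∀ u, u ∈ M.verts ↔ ν u ≠ u

variable {I}

theorem IsPairing.exists_represents {ν : V → V} (h : I.IsPairing ν) :
    ∃ M : I.graph.Subgraph, M.IsMatching ∧ I.Represents M ν := by
  let M : I.graph.Subgraph :=
    { verts := {u | ν u ≠ u}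
      Adj := fun u v => ν u = v ∧ u ≠ v
      adj_sub := by
        rintro u v ⟨rfl, hne⟩
        exact h.adj u hne.symm
      edge_vert := by
        rintro u v ⟨rfl, hne⟩
        exact hne.symm
      symm := ⟨by
        rintro u v ⟨rfl, hne⟩
        exact ⟨h.apply_apply u, hne.symm⟩⟩ }
  refine ⟨M, ?_, ⟨fun _ _ => Iff.rfl, fun _ => Iff.rfl⟩⟩
  intro u hu
  exact ⟨ν u, ⟨rfl, fun h' => hu h'.symm⟩, fun v hv => hv.1.symm⟩

theorem exists_pairing {M : I.graph.Subgraph} (hM : M.IsMatching) :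
    ∃ ν, I.IsPairing ν ∧ I.Represents M ν := by
  classical
  have key : ∀ u, ∃ v, (u ∈ M.verts → M.Adj u v) ∧ (u ∉ M.verts → v = u) := by
    intro u
    by_cases hu : u ∈ M.verts
    · obtain ⟨v, hv, -⟩ := hM hu
      exact ⟨v, fun _ => hv, fun h => absurd hu h⟩
    · exact ⟨u, fun h => absurd h hu, fun _ => rfl⟩
  choose ν h1 h2 using key
  have hadj : ∀ u v, M.Adj u v ↔ ν u = v ∧ u ≠ v := by
    intro u v
    constructor
    · intro h
      have hu := M.edge_vert h
      exact ⟨(hM hu).unique (h1 u hu) h, h.ne⟩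
    · rintro ⟨rfl, hne⟩
      by_cases hu : u ∈ M.verts
      · exact h1 u hu
      · exact absurd (h2 u hu).symm hne
  have hverts : ∀ u, u ∈ M.verts ↔ ν u ≠ u := fun u =>
    ⟨fun hu he => (h1 u hu).ne he.symm, fun hne => by_contra fun hu => hne (h2 u hu)⟩
  refine ⟨ν, ⟨fun u => ?_, fun u hu => ?_⟩, ⟨hadj, hverts⟩⟩
  · by_cases hu : u ∈ M.verts
    · exact ((hadj _ _).1 (h1 u hu).symm).1
    · rw [h2 u hu, h2 u hu]
  · exact M.adj_sub ((hadj u (ν u)).2 ⟨rfl, hu.symm⟩)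

theorem vote_neg {u v w : V} (hv : v ≠ u → I.graph.Adj u v) (hw : w ≠ u → I.graph.Adj u w) :
    I.vote u v w = -I.vote u w v := by
  by_cases h1 : v = w
  · simp [vote, h1]
  by_cases h2 : w = u
  · subst h2
    simp [vote, h1, Ne.symm h1]
  by_cases h3 : v = u
  · subst h3
    simp [vote, h1, Ne.symm h1]
  have hs := I.strict u
  let v' : I.graph.neighborSet u := ⟨v, hv h3⟩
  let w' : I.graph.neighborSet u := ⟨w, hw h2⟩
  by_cases hp : I.Prefers u v w
  · have : ¬ I.Prefers u w v := fun hq => hs.irrefl v' (hs.trans v' w' v' hp hq)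
    simp [vote, h1, h2, h3, Ne.symm h1, hp, this]
  · have : I.Prefers u w v := by
      by_contra hq
      exact h1 (congrArg Subtype.val (hs.trichotomous v' w' hp hq))
    simp [vote, h1, h2, h3, Ne.symm h1, hp, this]

theorem vote_le_one (u v w : V) : I.vote u v w ≤ 1 := by
  unfold vote
  split_ifs <;> norm_num

theorem neg_one_le_vote (u v w : V) : -1 ≤ I.vote u v w := by
  unfold vote
  split_ifs <;> norm_num

@[simp]
theorem vote_self (u v : V) : I.vote u v v = 0 := by
  simp [vote]

theorem prefersMatching_iff {M N : I.graph.Subgraph} {μ ν : V → V} (hμ : I.IsPairing μ)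
    (hM : I.Represents M μ) (hN : I.Represents N ν) (u : V) :
    I.PrefersMatching u N M ↔ I.vote u (ν u) (μ u) = 1 := by
  have irr : μ u ≠ u → ¬ I.Prefers u (μ u) (μ u) := fun h hp =>
    (I.strict u).irrefl ⟨μ u, hμ.adj u h⟩ hp
  simp only [PrefersMatching, hM.mem_verts_iff, hN.mem_verts_iff, hM.adj_iff, hN.adj_iff, vote]
  by_cases h2 : μ u = u
  · by_cases h1 : ν u = u
    · simp [h1, h2]
    · simp [h1, h2]
  · by_cases h1 : ν u = u
    · have : ¬ u = μ u := Ne.symm h2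
      simp only [h1, h2, this, if_true, if_false]
      constructor
      · rintro (h | ⟨v, w, h, -⟩)
        · exact absurd rfl h.1
        · exact absurd h.1 h.2
      · intro h
        norm_num at h
    · by_cases h3 : ν u = μ u
      · simp only [h3, if_true]
        constructor
        · rintro (h | ⟨v, w, ⟨rfl, -⟩, ⟨rfl, -⟩, hp⟩)
          · exact absurd h.2 (not_not_intro h2)
          · exact absurd hp (irr h2)
        · intro h
          norm_num at h
      · simp only [h1, h2, h3, if_false]
        constructor
        · rintro (h | ⟨v, w, ⟨rfl, -⟩, ⟨rfl, -⟩, hp⟩)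
          · exact absurd h.2 (not_not_intro h2)
          · simp [hp]
        · intro h
          refine Or.inr ⟨ν u, μ u, ⟨rfl, Ne.symm h1⟩, ⟨rfl, Ne.symm h2⟩, ?_⟩
          by_contra hp
          simp [hp] at h

/-- A moved node changes side, so using σ on one side and its inverse on the other gives an
involution. Thus a permutation along edges and loops splits into two matchings, one for σ and one
for its inverse. -/
theorem isPairing_of_perm [DecidablePred (· ∈ I.A)] (σ : Equiv.Perm V)
    (hσ : ∀ u, u = σ u ∨ I.graph.Adj u (σ u)) :
    I.IsPairing fun u => if u ∈ I.A then σ u else σ⁻¹ u := by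
  have hσ' : ∀ u, u = σ⁻¹ u ∨ I.graph.Adj u (σ⁻¹ u) := fun u => by
    rcases hσ (σ⁻¹ u) with h | h
    · left
      simpa using h.symm
    · right
      simpa using h.symm
  have hd := Set.disjoint_left.1 I.bipartite.disjoint
  constructor
  · intro u
    by_cases hu : u ∈ I.A
    · simp only [hu, if_true]
      rcases hσ u with h | h
      · rw [← h, if_pos hu, ← h]
      · have : σ u ∉ I.A := by
          rcases I.bipartite.mem_of_adj h with h | h
          · exact fun h' => hd h' h.2
          · exact absurd h.1 (hd hu)
        rw [if_neg this]
        simp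
    · simp only [hu, if_false]
      rcases hσ' u with h | h
      · rw [← h, if_neg hu, ← h]
      · have : σ⁻¹ u ∈ I.A := by
          rcases I.bipartite.mem_of_adj h with h | h
          · exact absurd h.1 hu
          · exact h.2
        rw [if_pos this]
        simp
  · intro u
    by_cases hu : u ∈ I.A
    · simp only [hu, if_true]
      exact fun h => (hσ u).resolve_left (Ne.symm h)
    · simp only [hu, if_false]
      exact fun h => (hσ' u).resolve_left (Ne.symm h)

variable [Fintype V]

theorem votes_sub_votes {M N : I.graph.Subgraph} {μ ν : V → V} (hμ : I.IsPairing μ)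
    (hν : I.IsPairing ν) (hM : I.Represents M μ) (hN : I.Represents N ν) :
    (I.votes N M : ℤ) - I.votes M N = ∑ u, I.vote u (ν u) (μ u) := by
  classical
  have count : ∀ P : V → Prop, (({u | P u} : Set V).ncard : ℤ) = ∑ u, if P u then 1 else 0 := by
    intro P
    rw [Set.ncard_eq_toFinset_card', Finset.sum_boole]
    simp
  simp only [votes, count, prefersMatching_iff hμ hM hN, prefersMatching_iff hν hN hM]
  rw [← Finset.sum_sub_distrib]
  refine Finset.sum_congr rfl fun u _ => ?_
  rw [vote_neg (hμ.adj u) (hν.adj u)]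
  have h1 := vote_le_one (I := I) u (ν u) (μ u)
  have h2 := neg_one_le_vote (I := I) u (ν u) (μ u)
  split_ifs <;> omega

theorem isPopularMatching_iff {M : I.graph.Subgraph} {μ : V → V} (hμ : I.IsPairing μ)
    (hMm : M.IsMatching) (hM : I.Represents M μ) :
    I.IsPopularMatching M ↔ ∀ ν, I.IsPairing ν → ∑ u, I.vote u (ν u) (μ u) ≤ 0 := by
  constructor
  · intro h ν hν
    obtain ⟨N, hNm, hN⟩ := hν.exists_represents
    have h1 := h.2 N hNm
    have h2 := votes_sub_votes hμ hν hM hN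
    omega
  · refine fun h => ⟨hMm, fun N hNm => ?_⟩
    obtain ⟨ν, hν, hN⟩ := exists_pairing hNm
    have h1 := h ν hν
    have h2 := votes_sub_votes hμ hν hM hN
    omega

theorem IsPairing.sum_comp {ν : V → V} (h : I.IsPairing ν) (f : V → ℤ) :
    ∑ u, f (ν u) = ∑ u, f u :=
  Equiv.sum_comp (Function.Involutive.toPerm ν h.apply_apply) f

/-- Weak duality: a certificate makes a pairing popular. -/
theorem sum_vote_nonpos {μ : V → V} (hμ : I.IsPairing μ) (α : V → ℤ)
    (hα : ∀ u, α u + α (μ u) = 0) (hself : ∀ u, I.vote u u (μ u) ≤ α u)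
    (hedge : ∀ u v, I.graph.Adj u v → I.vote u v (μ u) + I.vote v u (μ v) ≤ α u + α v)
    {ν : V → V} (hν : I.IsPairing ν) : ∑ u, I.vote u (ν u) (μ u) ≤ 0 := by
  have h0 : ∑ u, (α u + α (μ u)) = 0 := Finset.sum_eq_zero fun u _ => hα u
  rw [Finset.sum_add_distrib, hμ.sum_comp] at h0
  have h1 : ∑ u, (I.vote u (ν u) (μ u) + I.vote (ν u) (ν (ν u)) (μ (ν u))) ≤
      ∑ u, (α u + α (ν u)) := by
    refine Finset.sum_le_sum fun u _ => ?_
    rw [hν.apply_apply]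
    by_cases hu : ν u = u
    · rw [hu]
      linarith [hself u]
    · exact hedge u (ν u) (hν.adj u hu)
  rw [Finset.sum_add_distrib, Finset.sum_add_distrib, hν.sum_comp,
    hν.sum_comp fun u => I.vote u (ν u) (μ u)] at h1
  linarith

/-- Strong duality: a popular pairing has a (half-integral, here doubled) certificate. -/
theorem exists_certificate {μ : V → V}
    (h : ∀ ν, I.IsPairing ν → ∑ u, I.vote u (ν u) (μ u) ≤ 0) :
    ∃ β : V → ℤ, ∑ u, β u ≤ 0 ∧ (∀ u, 2 * I.vote u u (μ u) ≤ β u) ∧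
      ∀ u v, I.graph.Adj u v → 2 * (I.vote u v (μ u) + I.vote v u (μ v)) ≤ β u + β v := by
  classical
  obtain ⟨f, g, hfg, hsum⟩ := exists_potentials (fun u v => u = v ∨ I.graph.Adj u v)
    (fun u v => I.vote u v (μ u) + I.vote v u (μ v)) (fun u => Or.inl rfl) (by
      intro σ hσ
      have hσ' : ∀ u, u = σ⁻¹ u ∨ I.graph.Adj u (σ⁻¹ u) := fun u => by
        rcases hσ (σ⁻¹ u) with h | h
        · left
          simpa using h.symm
        · right
          simpa using h.symm
      -- The weight of σ is the sum of the votes for its two matchings, each of which is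
      -- nonpositive.
      have h1 := h _ (isPairing_of_perm σ hσ)
      have h2 := h _ (isPairing_of_perm σ⁻¹ hσ')
      have h3 : ∑ u, I.vote (σ u) u (μ (σ u)) = ∑ u, I.vote u (σ⁻¹ u) (μ u) := by
        rw [← Equiv.sum_comp σ fun u => I.vote u (σ⁻¹ u) (μ u)]
        simp
      rw [Finset.sum_add_distrib, h3, ← Finset.sum_add_distrib]
      rw [inv_inv] at h2
      refine le_trans (le_of_eq ?_) (add_nonpos h1 h2)
      rw [← Finset.sum_add_distrib]
      refine Finset.sum_congr rfl fun u _ => ?_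
      split_ifs
      · rfl
      · exact add_comm _ _)
  -- Each edge is dominated in both orientations; adding the two inequalities symmetrizes the
  -- potentials and produces the factor 2.
  refine ⟨fun u => f u + g u, by rwa [Finset.sum_add_distrib], fun u => ?_, fun u v huv => ?_⟩
  · have := hfg u u (Or.inl rfl)
    linarith
  · have h1 := hfg u v (Or.inr huv)
    have h2 := hfg v u (Or.inr huv.symm)
    linarith

/-- Complementary slackness: a certificate of `μ` is tight on every pairing that does not lose
against `μ`. -/
theorem certificate_tight {μ ν : V → V} (hν : I.IsPairing ν) {β : V → ℤ} (hsum : ∑ u, β u ≤ 0)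
    (hself : ∀ u, 2 * I.vote u u (μ u) ≤ β u)
    (hedge : ∀ u v, I.graph.Adj u v → 2 * (I.vote u v (μ u) + I.vote v u (μ v)) ≤ β u + β v)
    (h : 0 ≤ ∑ u, I.vote u (ν u) (μ u)) (u : V) :
    β u + β (ν u) = 2 * (I.vote u (ν u) (μ u) + I.vote (ν u) u (μ (ν u))) := by
  have hle : ∀ u ∈ Finset.univ,
      2 * (I.vote u (ν u) (μ u) + I.vote (ν u) (ν (ν u)) (μ (ν u))) ≤ β u + β (ν u) := by
    intro u _
    rw [hν.apply_apply]
    by_cases hu : ν u = u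
    · rw [hu]
      linarith [hself u]
    · exact hedge u (ν u) (hν.adj u hu)
  -- The termwise bounds sum to a quantity at most 0 on the right and at least 0 on the left, so
  -- each of them is an equality.
  have heq : ∑ u, 2 * (I.vote u (ν u) (μ u) + I.vote (ν u) (ν (ν u)) (μ (ν u))) =
      ∑ u, (β u + β (ν u)) := by
    apply le_antisymm (Finset.sum_le_sum hle)
    rw [← Finset.mul_sum, Finset.sum_add_distrib, Finset.sum_add_distrib, hν.sum_comp,
      hν.sum_comp fun u => I.vote u (ν u) (μ u)]
    linarith
  have := (Finset.sum_eq_sum_iff_of_le hle).1 heq u (Finset.mem_univ u)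
  rw [hν.apply_apply] at this
  exact this.symm

end BipartiteInstance

namespace Formula

open Node

/-! ### Block ranks and votes in the gadget graph -/

/-- The position of the block of `v` in the list of `u`, for `v` on that list. -/
def rank (φ : Formula) : φ.GNode → φ.GNode → ℕ
  | a0, z | b0, zPrime => 1
  | z, p1 _ _ | zPrime, q0 _ _ => 1
  | z, a0 | zPrime, b0 => 2
  | z, a1 _ _ | zPrime, b1 _ _ => 3
  | a1 _ _, yPrime _ | b1 _ _, xPrime _ => 1
  | a1 _ _, b2 _ _ | b1 _ _, a1 _ _ => 2
  | a1 _ _, z | b1 _ _, zPrime => 3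
  | a2 _ _, b1 _ _ | b2 _ _, a2 _ _ => 1
  | x _, yPrime _ | y _, xPrime _ => 1
  | x _, z | y _, zPrime => 2
  | x _, q2 _ _ | y _, p2 _ _ => 3
  | xPrime _, yPrime _ | yPrime _, xPrime _ => 1
  | xPrime _, b1 _ _ | yPrime _, a1 _ _ => 2
  | xPrime _, t0 _ | yPrime _, s0 _ => 2
  | p0 _ _, q2 _ _ | q0 _ _, p2 _ _ => 1
  | q0 _ _, zPrime | p1 _ _, z => 2
  | q0 _ _, s0 _ | p1 _ _, t0 _ => 3
  | p1 _ _, q2 _ _ | q1 _ _, p2 _ _ => 1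
  | p2 _ _, y _ | q2 _ _, x _ => 1
  | p2 _ _, q1 _ _ | q2 _ _, p0 _ _ => 2
  | p2 _ _, q2 _ _ | q2 _ _, p2 _ _ => 3
  | p2 _ _, t0 _ | q2 _ _, s0 _ => 4
  | s0 _, t _ r => 2 * r
  | s0 _, q0 _ g => 2 * g + 1
  | s0 _, yPrime _ | s0 _, q2 _ _ => 5
  | t0 _, s _ r => 4 - 2 * r
  | t0 _, p1 _ g => 5 - 2 * g
  | t0 _, xPrime _ | t0 _, p2 _ _ => 5
  | s _ _, t0 _ | t _ _, s0 _ => 1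
  -- Covers the first blocks of the lists; on pairs that are not listed the value is meaningless.
  | _, _ => 0

set_option maxHeartbeats 1000000 in
theorem blockIndex_eq_rank (φ : Formula) {u v : φ.GNode} (h : φ.Listed u v) :
    φ.blockIndex u v = φ.rank u v := by
  simp only [Listed] at h
  cases u <;> cases v <;> simp [prefBlocks] at h <;>
    simp [blockIndex, prefBlocks, List.findIdx_cons, rank, h]
  case s0.q0 | t0.p1 => obtain ⟨rfl, rfl⟩ | ⟨rfl, rfl⟩ := h <;> simp
  case s0.t | t0.s => obtain ⟨rfl, rfl⟩ | ⟨rfl, rfl⟩ | ⟨rfl, rfl⟩ := h <;> simp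

section Votes

variable {φ : Formula} {tie : φ.GNode → φ.GNode → ℕ} {htie : ∀ u, Function.Injective (tie u)}

theorem vote_eq_one_of_unmatched {u v : φ.GNode} (h : v ≠ u) :
    (φ.gadgetInstance tie htie).vote u v u = 1 := by
  simp [BipartiteInstance.vote, h]

theorem vote_unmatched {u v : φ.GNode} (h : v ≠ u) :
    (φ.gadgetInstance tie htie).vote u u v = -1 := by
  simp [BipartiteInstance.vote, h, h.symm]

theorem vote_eq_one_of_rank_lt {u v w : φ.GNode} (hv : φ.Listed u v) (hw : φ.Listed u w)
    (h : φ.rank u v < φ.rank u w) : (φ.gadgetInstance tie htie).vote u v w = 1 := by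
  have hvw : v ≠ w := by
    rintro rfl
    exact lt_irrefl _ h
  have hp : φ.GadgetPrefers tie u v w := by
    left
    rwa [blockIndex_eq_rank φ hv, blockIndex_eq_rank φ hw]
  have hp' : (φ.gadgetInstance tie htie).Prefers u v w := hp
  have h1 : v ≠ u := (SimpleGraph.Adj.ne (G := φ.gadgetGraph) hv).symm
  have h2 : w ≠ u := (SimpleGraph.Adj.ne (G := φ.gadgetGraph) hw).symm
  simp [BipartiteInstance.vote, hvw, h1, h2, hp']

theorem vote_eq_neg_one_of_rank_lt {u v w : φ.GNode} (hv : φ.Listed u v) (hw : φ.Listed u w)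
    (h : φ.rank u w < φ.rank u v) : (φ.gadgetInstance tie htie).vote u v w = -1 := by
  rw [BipartiteInstance.vote_neg (fun _ => hv) (fun _ => hw), vote_eq_one_of_rank_lt hw hv h]

end Votes

theorem fin_three_cases (k : Fin 3) : k = 0 ∨ k = 1 ∨ k = 2 := by
  revert k
  decide

theorem fin_three_neg_one : (-1 : Fin 3) = 2 := rfl

theorem fin_three_neg_two : (-2 : Fin 3) = 1 := rfl

/-! ### The matching encoding an assignment, and its certificate -/

section Pairing

variable (φ : Formula) (τ : Fin φ.numVars → Bool) (ρ : Fin φ.numClauses → Option (Fin 3))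

/-- The state of gadget `g` of clause `c` when `ρ c` is the position of its true literal: `1` if
the literal at position `g + 2` is true, `2` if the one at `g + 1` is true, and `0` otherwise. -/
def gadgetState (c : Fin φ.numClauses) (g : Fin 3) : Fin 3 := (ρ c).elim 0 fun r => g - r

/-- The matching that encodes the assignment `τ`, where `ρ c` is the position of the true literal
of clause `c`, if there is one. -/
def pairing : φ.GNode → φ.GNode
  | a0 => b0
  | b0 => a0
  | z => z
  | zPrime => zPrime
  | a1 c g => if φ.gadgetState ρ c g = 1 then b2 c g else b1 c g
  | a2 c g => if φ.gadgetState ρ c g = 1 then b1 c g else b2 c g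
  | b1 c g => if φ.gadgetState ρ c g = 1 then a2 c g else a1 c g
  | b2 c g => if φ.gadgetState ρ c g = 1 then a1 c g else a2 c g
  | x i => if τ i then yPrime i else y i
  | xPrime i => if τ i then y i else yPrime i
  | y i => if τ i then xPrime i else x i
  | yPrime i => if τ i then x i else xPrime i
  | p0 c g => if φ.gadgetState ρ c g = 1 then q2 c g else q0 c g
  | p1 c g => if φ.gadgetState ρ c g = 2 then q2 c g else q1 c g
  | p2 c g => if φ.gadgetState ρ c g = 1 then q0 c g
      else if φ.gadgetState ρ c g = 2 then q1 c g else q2 c g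
  | q0 c g => if φ.gadgetState ρ c g = 1 then p2 c g else p0 c g
  | q1 c g => if φ.gadgetState ρ c g = 2 then p2 c g else p1 c g
  | q2 c g => if φ.gadgetState ρ c g = 1 then p0 c g
      else if φ.gadgetState ρ c g = 2 then p1 c g else p2 c g
  | s0 c => (ρ c).elim (s0 c) (t c)
  | t0 c => (ρ c).elim (t0 c) (s c)
  | s c r => if ρ c = some r then t0 c else t c r
  | t c r => if ρ c = some r then s0 c else s c r

/-- The certificate for `pairing`. -/
def certificate : φ.GNode → ℤ
  | x i | y i => if τ i then 1 else 0
  | xPrime i | yPrime i => if τ i then -1 else 0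
  | p0 c g => if φ.gadgetState ρ c g = 1 then 1 else if φ.gadgetState ρ c g = 2 then -1 else 0
  | q1 c g => if φ.gadgetState ρ c g = 1 then -1 else if φ.gadgetState ρ c g = 2 then 1 else 0
  | p1 c g | q0 c g => if φ.gadgetState ρ c g = 0 then 0 else 1
  | p2 c g | q2 c g => if φ.gadgetState ρ c g = 0 then 0 else -1
  | s0 c | t0 c => (ρ c).elim 0 fun _ => -1
  | s c j => (ρ c).elim 0 fun r => if j < r then -1 else 1
  | t c j => (ρ c).elim 0 fun r => if r < j then -1 else 1
  | _ => 0

theorem pairing_pairing (u : φ.GNode) : φ.pairing τ ρ (φ.pairing τ ρ u) = u := by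
  cases u
  case s0 c | t0 c => rcases h : ρ c with _ | r <;> simp [pairing, h]
  all_goals simp only [pairing]
  all_goals split_ifs <;> simp_all

theorem certificate_pairing (u : φ.GNode) :
    φ.certificate τ ρ u + φ.certificate τ ρ (φ.pairing τ ρ u) = 0 := by
  cases u
  case s0 c | t0 c => rcases h : ρ c with _ | r <;> simp [pairing, certificate, h]
  case s c j | t c j =>
    rcases h : ρ c with _ | r
    · simp [pairing, certificate, h]
    · fin_cases j <;> fin_cases r <;> simp_all [pairing, certificate]
  case p0 c g | p1 c g | p2 c g | q0 c g | q1 c g | q2 c g =>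
    rcases fin_three_cases (φ.gadgetState ρ c g) with h | h | h <;> simp [pairing, certificate, h]
  all_goals simp only [pairing, certificate]
  all_goals try split_ifs
  all_goals simp_all

theorem listed_pairing (u : φ.GNode) (hu : φ.pairing τ ρ u ≠ u) :
    φ.Listed u (φ.pairing τ ρ u) := by
  revert hu
  cases u
  case s0 c | t0 c =>
    rcases h : ρ c with _ | r
    · simp [pairing, h]
    · fin_cases r <;> simp [pairing, h, Listed, prefBlocks]
  all_goals simp only [pairing]
  all_goals try split_ifs
  all_goals simp [Listed, prefBlocks]

theorem pairing_eq_self_iff (hρ : ∀ c, ρ c ≠ none) (u : φ.GNode) :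
    φ.pairing τ ρ u = u ↔ u = z ∨ u = zPrime := by
  cases u
  case s0 c | t0 c =>
    obtain ⟨r, hr⟩ := Option.ne_none_iff_exists'.1 (hρ c)
    simp [pairing, hr]
  all_goals simp only [pairing]
  all_goals try split_ifs
  all_goals simp

/-- An upper bound for the vote of `u` for `v` against its partner in `pairing`. -/
def score (u v : φ.GNode) : ℤ :=
  if v = φ.pairing τ ρ u then 0
  else if φ.pairing τ ρ u ≠ u ∧ φ.rank u (φ.pairing τ ρ u) < φ.rank u v then -1 else 1

/-- Counting every comparison inside a block as a favourable vote yields a bound that is independent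
of `tie`. -/
theorem vote_le_score {tie : φ.GNode → φ.GNode → ℕ} {htie : ∀ u, Function.Injective (tie u)}
    {u v : φ.GNode} (h : φ.Listed u v) :
    (φ.gadgetInstance tie htie).vote u v (φ.pairing τ ρ u) ≤ φ.score τ ρ u v := by
  unfold score
  split_ifs with h1 h2
  · simp [h1]
  · exact (vote_eq_neg_one_of_rank_lt h (φ.listed_pairing τ ρ u h2.1) h2.2).le
  · exact BipartiteInstance.vote_le_one _ _ _

set_option maxHeartbeats 4000000 in
theorem score_add_score_le (hτ : ∀ c j, τ (φ.clause c j) = decide (ρ c = some j))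
    (hρ : ∀ c, ρ c = none → (∀ i, τ i = false) ∧ ∀ d, ρ d = none)
    {u v : φ.GNode} (hu : u ∈ φ.sideA) (h : φ.Listed u v) :
    φ.score τ ρ u v + φ.score τ ρ v u ≤ φ.certificate τ ρ u + φ.certificate τ ρ v := by
  simp only [Listed] at h
  cases u <;> simp [sideA] at hu <;> cases v <;> simp [prefBlocks] at h
  case a0.b0 | a0.z | zPrime.b0 => simp [score, pairing, certificate, rank]
  case zPrime.b1 c g | zPrime.q0 c g | a1.z c g | p1.z c g =>
    rcases fin_three_cases (φ.gadgetState ρ c g) with h | h | h <;>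
      simp [score, pairing, certificate, rank, h]
  case zPrime.y i | x.z i =>
    cases h : τ i <;> simp [score, pairing, certificate, rank, h]
  case a1.b1 c g d e | a1.b2 c g d e | a2.b1 c g d e | a2.b2 c g d e | p0.q0 c g d e |
      p0.q2 c g d e | p1.q1 c g d e | p1.q2 c g d e | p2.q0 c g d e | p2.q1 c g d e | p2.q2 c g d e =>
    obtain ⟨rfl, rfl⟩ := h
    rcases fin_three_cases (φ.gadgetState ρ d e) with h | h | h <;>
      simp [score, pairing, certificate, rank, h]
  case x.y i j | x.yPrime i j | xPrime.y i j | xPrime.yPrime i j =>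
    subst h
    cases h : τ j <;> simp [score, pairing, certificate, rank, h]
  case a1.yPrime c g i | p2.y c g i | x.q2 i c g | xPrime.b1 i c g =>
    subst h
    rcases h : ρ c with _ | r
    · simp [score, pairing, certificate, rank, gadgetState, h, hτ]
    · fin_cases g <;> fin_cases r <;>
        simp [score, pairing, certificate, rank, gadgetState, fin_three_neg_one, fin_three_neg_two, h, hτ]
  case p1.t0 c g d =>
    obtain ⟨hg, rfl⟩ := h
    rcases h : ρ d with _ | r
    · simp [score, pairing, certificate, rank, gadgetState, h]
    · fin_cases g <;> fin_cases r <;>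
        simp [score, pairing, certificate, rank, gadgetState, h] at hg ⊢
  case s0.q0 d c g =>
    have h' : c = d ∧ g ≠ 2 := by
      rcases h with ⟨rfl, rfl⟩ | ⟨rfl, rfl⟩ <;> simp
    obtain ⟨rfl, hg⟩ := h'
    rcases h : ρ c with _ | r
    · simp [score, pairing, certificate, rank, gadgetState, h]
    · fin_cases g <;> fin_cases r <;>
        simp [score, pairing, certificate, rank, gadgetState, fin_three_neg_one, fin_three_neg_two, h] at hg ⊢
  case s0.t d c j =>
    have h' : c = d := by tauto
    subst h'
    rcases h : ρ c with _ | r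
    · simp [score, pairing, certificate, rank, h]
    · fin_cases j <;> fin_cases r <;>
        simp [score, pairing, certificate, rank, h]
  case s.t0 d j c =>
    subst h
    rcases h : ρ c with _ | r
    · simp [score, pairing, certificate, rank, h]
    · fin_cases j <;> fin_cases r <;>
        simp [score, pairing, certificate, rank, h]
  case s.t d j c k =>
    obtain ⟨rfl, rfl⟩ := h
    rcases h : ρ c with _ | r
    · simp [score, pairing, certificate, h]
    · fin_cases k <;> fin_cases r <;>
        simp [score, pairing, certificate, rank, h]
  case s0.yPrime c i | xPrime.t0 i c =>
    rcases h : ρ c with _ | r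
    · simp [score, pairing, certificate, rank, h, (hρ c h).1]
    · cases h' : τ i <;> fin_cases r <;> simp [score, pairing, certificate, rank, h, h']
  case s0.q2 d c g | p2.t0 c g d =>
    rcases h : ρ d with _ | r
    · simp [score, pairing, certificate, rank, gadgetState, h, (hρ d h).2]
    · rcases fin_three_cases (φ.gadgetState ρ c g) with h' | h' | h' <;> fin_cases r <;>
        simp [score, pairing, certificate, rank, h, h']

theorem isPairing_pairing {tie : φ.GNode → φ.GNode → ℕ}
    {htie : ∀ u, Function.Injective (tie u)} :
    (φ.gadgetInstance tie htie).IsPairing (φ.pairing τ ρ) :=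
  ⟨φ.pairing_pairing τ ρ, φ.listed_pairing τ ρ⟩

theorem neg_one_le_certificate (u : φ.GNode) : -1 ≤ φ.certificate τ ρ u := by
  cases u
  case s0 c | t0 c | s c j | t c j =>
    rcases h : ρ c with _ | r
    · simp [certificate, h]
    · simp only [certificate, h, Option.elim_some]
      try split_ifs
      all_goals norm_num
  all_goals simp only [certificate]
  all_goals try split_ifs
  all_goals norm_num

theorem sum_vote_pairing_nonpos {tie : φ.GNode → φ.GNode → ℕ}
    {htie : ∀ u, Function.Injective (tie u)}
    (hτ : ∀ c j, τ (φ.clause c j) = decide (ρ c = some j))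
    (hρ : ∀ c, ρ c = none → (∀ i, τ i = false) ∧ ∀ d, ρ d = none)
    {ν : φ.GNode → φ.GNode} (hν : (φ.gadgetInstance tie htie).IsPairing ν) :
    ∑ u, (φ.gadgetInstance tie htie).vote u (ν u) (φ.pairing τ ρ u) ≤ 0 := by
  refine BipartiteInstance.sum_vote_nonpos (φ.isPairing_pairing τ ρ) (φ.certificate τ ρ)
    (φ.certificate_pairing τ ρ) (fun u => ?_) (fun u v huv => ?_) hν
  · have h1 := φ.certificate_pairing τ ρ u
    by_cases h : φ.pairing τ ρ u = u
    · rw [h, BipartiteInstance.vote_self]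
      rw [h] at h1
      linarith
    · rw [vote_unmatched h]
      exact φ.neg_one_le_certificate τ ρ u
  · have huv' : φ.Listed u v := huv
    have hvu := φ.listed_symm huv'
    have h1 := φ.vote_le_score τ ρ (tie := tie) (htie := htie) huv'
    have h2 := φ.vote_le_score τ ρ (tie := tie) (htie := htie) hvu
    rcases φ.listed_sides huv' with h | h
    · have := φ.score_add_score_le τ ρ hτ hρ h.1 huv'
      linarith
    · have := φ.score_add_score_le τ ρ hτ hρ h.2 hvu
      linarith

end Pairing

theorem exists_popular_of_oneInThreeSat (φ : Formula) (tie : φ.GNode → φ.GNode → ℕ)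
    (htie : ∀ u, Function.Injective (tie u)) (h : φ.OneInThreeSat) :
    ∃ M : (φ.gadgetInstance tie htie).graph.Subgraph,
      (φ.gadgetInstance tie htie).IsPopularMatching M ∧ M.verts = {z, zPrime}ᶜ := by
  obtain ⟨τ, hτ⟩ := h
  choose r hr hr' using hτ
  let ρ : Fin φ.numClauses → Option (Fin 3) := fun c => some (r c)
  have hτρ : ∀ c j, τ (φ.clause c j) = decide (ρ c = some j) := by
    intro c j
    by_cases hj : r c = j
    · simp only [ρ, hj, decide_true]
      rw [← hj]
      exact hr c
    · have : ¬ τ (φ.clause c j) = true := fun h => hj (hr' c j h).symm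
      simp [ρ, hj, this]
  have hμ := φ.isPairing_pairing τ ρ (tie := tie) (htie := htie)
  obtain ⟨M, hMm, hM⟩ := hμ.exists_represents
  refine ⟨M, (BipartiteInstance.isPopularMatching_iff hμ hMm hM).2 fun ν hν =>
    φ.sum_vote_pairing_nonpos τ ρ hτρ (by simp [ρ]) hν, ?_⟩
  ext u
  rw [hM.mem_verts_iff, Ne, φ.pairing_eq_self_iff τ ρ (by simp [ρ])]
  simp

/-! ### Local constraints from a popular matching -/

/-- A pairing `μ` of all nodes but `z` and `z'`, together with a (doubled) certificate `β` of its
popularity. -/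
structure Certified (φ : Formula) (μ : φ.GNode → φ.GNode) (β : φ.GNode → ℤ) : Prop where
  apply_apply : ∀ u, μ (μ u) = u
  apply_eq_self_iff : ∀ u, μ u = u ↔ u = z ∨ u = zPrime
  listed_of_ne : ∀ u, μ u ≠ u → φ.Listed u (μ u)
  add_apply : ∀ u, β u + β (μ u) = 0
  neg_two_le : ∀ u, -2 ≤ β u
  z_eq : β z = 0
  zPrime_eq : β zPrime = 0
  s0_eq : ∀ c, β (s0 c) = -2
  t0_eq : ∀ c, β (t0 c) = -2
  nonneg_of_prefers : ∀ u v, φ.Listed u v → (μ u = u ∨ φ.rank u v < φ.rank u (μ u)) →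
    0 ≤ β u + β v
  four_le_of_prefers : ∀ u v, φ.Listed u v → (μ u = u ∨ φ.rank u v < φ.rank u (μ u)) →
    (μ v = v ∨ φ.rank v u < φ.rank v (μ v)) → 4 ≤ β u + β v

/-- The labels come from strong duality. Tightness on `M` itself makes matched labels opposite, and
tightness on the stable matching fixes the labels of `s0` and `t0`. -/
theorem exists_certified {φ : Formula} {tie : φ.GNode → φ.GNode → ℕ}
    {htie : ∀ u, Function.Injective (tie u)} {M : (φ.gadgetInstance tie htie).graph.Subgraph}
    (hM : (φ.gadgetInstance tie htie).IsPopularMatching M) (hverts : M.verts = {z, zPrime}ᶜ) :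
    ∃ μ β, φ.Certified μ β := by
  obtain ⟨μ, hμ, hMμ⟩ := BipartiteInstance.exists_pairing hM.1
  have hpop := (BipartiteInstance.isPopularMatching_iff hμ hM.1 hMμ).1 hM
  obtain ⟨β, hsum, hself, hedge⟩ := BipartiteInstance.exists_certificate hpop
  have hfix : ∀ u, μ u = u ↔ u = z ∨ u = zPrime := by
    intro u
    rw [← not_iff_not]
    have := hMμ.mem_verts_iff u
    rw [hverts] at this
    exact this.symm.trans (by simp)
  have hlisted : ∀ u, μ u ≠ u → φ.Listed u (μ u) := hμ.adj
  have tightM := BipartiteInstance.certificate_tight hμ hsum hself hedge (by simp)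
  have hadd : ∀ u, β u + β (μ u) = 0 := by
    intro u
    rw [tightM u, hμ.apply_apply]
    simp
  let S := φ.pairing (fun _ => false) (fun _ => none)
  have hS : (φ.gadgetInstance tie htie).IsPairing S := φ.isPairing_pairing _ _
  -- The stable matching is popular, so it does not lose to `μ`, and complementary slackness applies
  -- to it.
  have hSM : 0 ≤ ∑ u, (φ.gadgetInstance tie htie).vote u (S u) (μ u) := by
    have h := φ.sum_vote_pairing_nonpos (fun _ => false) (fun _ => none) (tie := tie)
      (htie := htie) (by simp) (by simp) hμ
    have h' : ∀ u, (φ.gadgetInstance tie htie).vote u (S u) (μ u) =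
        -(φ.gadgetInstance tie htie).vote u (μ u) (S u) := fun u =>
      BipartiteInstance.vote_neg (hS.adj u) (hμ.adj u)
    rw [Finset.sum_congr rfl fun u _ => h' u, Finset.sum_neg_distrib]
    exact neg_nonneg.2 h
  have tightS := BipartiteInstance.certificate_tight hS hsum hself hedge hSM
  -- A node alone in S but matched in `μ` votes -1 for being alone; tightness on its loop reads 2 β
  -- u = -4.
  have hunm : ∀ u, S u = u → μ u ≠ u → β u = -2 := by
    intro u h1 h2
    have := tightS u
    rw [h1, vote_unmatched h2] at this
    omega
  have hone : ∀ u v, φ.Listed u v → (μ u = u ∨ φ.rank u v < φ.rank u (μ u)) →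
      (φ.gadgetInstance tie htie).vote u v (μ u) = 1 := by
    intro u v huv h
    by_cases hu : μ u = u
    · rw [hu]
      exact vote_eq_one_of_unmatched (SimpleGraph.Adj.ne (G := φ.gadgetGraph) huv).symm
    · exact vote_eq_one_of_rank_lt huv (hlisted u hu) (h.resolve_left hu)
  have hz : ∀ u, μ u = u → β u = 0 := by
    intro u hu
    have := hadd u
    rw [hu] at this
    omega
  refine ⟨μ, β, hμ.apply_apply, hfix, hlisted, hadd, ?_, hz z ((hfix z).2 (Or.inl rfl)),
    hz zPrime ((hfix zPrime).2 (Or.inr rfl)), fun c => hunm _ rfl ?_, fun c => hunm _ rfl ?_,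
    ?_, ?_⟩
  · intro u
    have h1 := hself u
    have h2 := BipartiteInstance.neg_one_le_vote (I := φ.gadgetInstance tie htie) u u (μ u)
    omega
  · simp [hfix]
  · simp [hfix]
  · intro u v huv h
    have h1 := hedge u v huv
    have h2 := BipartiteInstance.neg_one_le_vote (I := φ.gadgetInstance tie htie) v u (μ v)
    rw [hone u v huv h] at h1
    omega
  · intro u v huv h h'
    have h1 := hedge u v huv
    rw [hone u v huv h, hone v u (φ.listed_symm huv) h'] at h1
    omega

namespace Certified

variable {φ : Formula} {μ : φ.GNode → φ.GNode} {β : φ.GNode → ℤ}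

theorem le_two (W : φ.Certified μ β) (u : φ.GNode) : β u ≤ 2 := by
  have h1 := W.add_apply u
  have h2 := W.neg_two_le (μ u)
  omega

theorem add_eq_zero (W : φ.Certified μ β) {u v : φ.GNode} (h : μ u = v) : β u + β v = 0 :=
  h ▸ W.add_apply u

theorem symm (W : φ.Certified μ β) {u v : φ.GNode} (h : μ u = v) : μ v = u :=
  h ▸ W.apply_apply u

theorem inj (W : φ.Certified μ β) {u v w : φ.GNode} (h : μ u = w) (h' : μ v = w) : u = v := by
  rw [← W.symm h, W.symm h']

theorem apply_z (W : φ.Certified μ β) : μ z = z := (W.apply_eq_self_iff z).2 (Or.inl rfl)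

theorem apply_zPrime (W : φ.Certified μ β) : μ zPrime = zPrime :=
  (W.apply_eq_self_iff zPrime).2 (Or.inr rfl)

theorem listed (W : φ.Certified μ β) (u : φ.GNode) (h : u ≠ z) (h' : u ≠ zPrime) :
    φ.Listed u (μ u) :=
  W.listed_of_ne u fun hu => ((W.apply_eq_self_iff u).1 hu).elim h h'

theorem apply_ne_z (W : φ.Certified μ β) (u : φ.GNode) (h : u ≠ z) : μ u ≠ z := fun hu =>
  h (W.inj hu W.apply_z)

theorem apply_ne_zPrime (W : φ.Certified μ β) (u : φ.GNode) (h : u ≠ zPrime) : μ u ≠ zPrime :=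
  fun hu => h (W.inj hu W.apply_zPrime)

/-! ### Level 1: variable gadgets -/

theorem apply_x (W : φ.Certified μ β) (i : Fin φ.numVars) :
    μ (x i) = y i ∨ μ (x i) = yPrime i := by
  have h := W.listed (x i) (by simp) (by simp)
  simp only [Listed, prefBlocks] at h
  simp [W.apply_ne_z] at h
  rcases h with h | h | ⟨c, g, -, h⟩
  · exact Or.inl h
  · exact Or.inr h
  -- Otherwise x and the unmatched z would prefer each other, requiring labels of sum 4, while z has
  -- label 0 and x at most 2.
  · have h1 := W.four_le_of_prefers (x i) z (by simp [Listed, prefBlocks]) (by simp [h, rank])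
      (Or.inl W.apply_z)
    have h2 := W.le_two (x i)
    have h3 := W.z_eq
    omega

theorem apply_y (W : φ.Certified μ β) (i : Fin φ.numVars) :
    μ (y i) = x i ∨ μ (y i) = xPrime i := by
  have h := W.listed (y i) (by simp) (by simp)
  simp only [Listed, prefBlocks] at h
  simp [W.apply_ne_zPrime] at h
  rcases h with h | h | ⟨c, g, -, h⟩
  · exact Or.inl h
  · exact Or.inr h
  · have h1 := W.four_le_of_prefers (y i) zPrime (by simp [Listed, prefBlocks])
      (by simp [h, rank]) (Or.inl W.apply_zPrime)
    have h2 := W.le_two (y i)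
    have h3 := W.zPrime_eq
    omega

/-- The unmatched z has label 0 and votes for every neighbour, so none of its neighbours has a
negative label. -/
theorem x_nonneg (W : φ.Certified μ β) (i : Fin φ.numVars) : 0 ≤ β (x i) := by
  have h := W.nonneg_of_prefers z (x i) (by simp [Listed, prefBlocks]) (Or.inl W.apply_z)
  rwa [W.z_eq, zero_add] at h

theorem y_nonneg (W : φ.Certified μ β) (i : Fin φ.numVars) : 0 ≤ β (y i) := by
  have h := W.nonneg_of_prefers zPrime (y i) (by simp [Listed, prefBlocks]) (Or.inl W.apply_zPrime)
  rwa [W.zPrime_eq, zero_add] at h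

/-- If `x` is matched to `y'`, then `x'` is matched to `y`, and the labels are determined. -/
theorem labels_of_apply_x_eq_yPrime (W : φ.Certified μ β) {i : Fin φ.numVars}
    (h : μ (x i) = yPrime i) : β (xPrime i) = -2 ∧ β (yPrime i) = -2 := by
  have hy : μ (y i) = xPrime i := by
    rcases W.apply_y i with hy | hy
    · have := W.symm hy
      rw [h] at this
      simp at this
    · exact hy
  -- The edge xy blocks, so x and y both have the maximal label 2 and their partners have -2.
  have h1 := W.four_le_of_prefers (x i) (y i) (by simp [Listed, prefBlocks])
    (by simp [h, rank]) (by simp [hy, rank])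
  have h2 := W.le_two (x i)
  have h3 := W.le_two (y i)
  have h4 := W.add_eq_zero h
  have h5 := W.add_eq_zero hy
  omega

theorem apply_x_eq_yPrime_of_pos (W : φ.Certified μ β) {i : Fin φ.numVars}
    (h : 0 < β (x i) ∨ 0 < β (y i)) : μ (x i) = yPrime i := by
  refine (W.apply_x i).resolve_left fun hx => ?_
  have h1 := W.x_nonneg i
  have h2 := W.y_nonneg i
  have h3 := W.add_eq_zero hx
  omega

/-- If `x` is matched to `y` but `x'` is not matched to `y'`, then `x'` and `y'` both have the
maximum label. -/
theorem labels_of_apply_xPrime_ne (W : φ.Certified μ β) {i : Fin φ.numVars}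
    (h : μ (x i) = y i) (h' : μ (xPrime i) ≠ yPrime i) : β (xPrime i) = 2 ∧ β (yPrime i) = 2 := by
  have hx : μ (xPrime i) ≠ y i := fun hx => by simpa using W.inj hx h
  have hy : μ (yPrime i) ≠ x i := fun hy => by
    have := W.symm hy
    rw [h] at this
    simp at this
  have hy' : μ (yPrime i) ≠ xPrime i := fun hy => h' (W.symm hy)
  have l1 := W.listed (xPrime i) (by simp) (by simp)
  have l2 := W.listed (yPrime i) (by simp) (by simp)
  -- With y and y' excluded, x' is matched into its last block, and symmetrically for y'; hence the
  -- edge x'y' blocks.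
  have r1 : φ.rank (xPrime i) (μ (xPrime i)) = 2 := by
    simp only [Listed, prefBlocks] at l1
    simp [hx, h'] at l1
    rcases l1 with ⟨c, g, -, e⟩ | ⟨c, e⟩ <;> rw [e] <;> rfl
  have r2 : φ.rank (yPrime i) (μ (yPrime i)) = 2 := by
    simp only [Listed, prefBlocks] at l2
    simp [hy, hy'] at l2
    rcases l2 with ⟨c, g, -, e⟩ | ⟨c, e⟩ <;> rw [e] <;> rfl
  have h1 := W.four_le_of_prefers (xPrime i) (yPrime i) (by simp [Listed, prefBlocks])
    (Or.inr (by rw [r1]; simp [rank])) (Or.inr (by rw [r2]; simp [rank]))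
  have h2 := W.le_two (xPrime i)
  have h3 := W.le_two (yPrime i)
  omega

/-! ### Level 0: no two true literals -/

/-- The only other possibility has `a1` matched to some y' and `b1` to some x'. Those variable nodes
then have label 2, so `a1` and `b1` have -2, although `a1` prefers `b1` to its partner. -/
theorem apply_a (W : φ.Certified μ β) (c : Fin φ.numClauses) (g : Fin 3) :
    μ (a1 c g) = b1 c g ∧ μ (a2 c g) = b2 c g ∨ μ (a1 c g) = b2 c g ∧ μ (a2 c g) = b1 c g := by
  have ha1 := W.listed (a1 c g) (by simp) (by simp)
  have ha2 := W.listed (a2 c g) (by simp) (by simp)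
  have hb1 := W.listed (b1 c g) (by simp) (by simp)
  have hb2 := W.listed (b2 c g) (by simp) (by simp)
  simp only [Listed, prefBlocks] at ha1 ha2 hb1 hb2
  simp [W.apply_ne_z, W.apply_ne_zPrime] at ha1 ha2 hb1 hb2
  rcases ha2 with ha2 | ha2
  · left
    refine ⟨?_, ha2⟩
    rcases ha1 with ha1 | ha1 | ha1
    · exact ha1
    · exfalso
      have hb1 : μ (b1 c g) = xPrime (φ.clause c (g + 2)) := by
        rcases hb1 with hb1 | hb1 | hb1
        · simpa using (W.symm hb1).symm.trans ha2
        · exact hb1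
        · simpa using (W.symm hb1).symm.trans ha1
      have hxu : μ (x (φ.clause c (g + 1))) = y (φ.clause c (g + 1)) :=
        (W.apply_x _).resolve_right fun h => by simpa using W.inj h ha1
      have hxv : μ (x (φ.clause c (g + 2))) = y (φ.clause c (g + 2)) := by
        refine (W.apply_x _).resolve_right fun h => ?_
        rcases W.apply_y (φ.clause c (g + 2)) with h' | h'
        · simpa using (W.symm h').symm.trans h
        · simpa using (W.symm h').symm.trans (W.symm hb1)
      have h1 := (W.labels_of_apply_xPrime_ne hxu fun h => by simpa using W.inj h ha1).2
      have h2 := (W.labels_of_apply_xPrime_ne hxv fun h => by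
        simpa using (W.symm hb1).symm.trans h).1
      have h3 := W.add_eq_zero ha1
      have h4 := W.add_eq_zero hb1
      have h5 := W.nonneg_of_prefers (a1 c g) (b1 c g) (by simp [Listed, prefBlocks])
        (by simp [ha1, rank])
      omega
    · simpa using W.inj ha1 ha2
  · right
    refine ⟨?_, ha2⟩
    rcases hb2 with hb2 | hb2
    · exact W.symm hb2
    · simpa using (W.symm hb2).symm.trans ha2

/-- Level 0 forbids that both literals of a gadget are true. -/
theorem not_both_true (W : φ.Certified μ β) (c : Fin φ.numClauses) (g : Fin 3)
    (h1 : μ (x (φ.clause c (g + 1))) = yPrime (φ.clause c (g + 1)))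
    (h2 : μ (x (φ.clause c (g + 2))) = yPrime (φ.clause c (g + 2))) : False := by
  have hz := W.nonneg_of_prefers z (a1 c g) (by simp [Listed, prefBlocks]) (Or.inl W.apply_z)
  have hz' := W.nonneg_of_prefers zPrime (b1 c g) (by simp [Listed, prefBlocks])
    (Or.inl W.apply_zPrime)
  have l1 := (W.labels_of_apply_x_eq_yPrime h1).2
  have l2 := (W.labels_of_apply_x_eq_yPrime h2).1
  have e1 := W.z_eq
  have e2 := W.zPrime_eq
  -- In the parallel state `a1` and `b1` have opposite nonnegative labels, hence 0, but `b1` prefers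
  -- an x' labelled -2. In the crossed state `a1` prefers a y' labelled -2, so `a1` has label 2,
  -- `b2` has -2, `a2` has 2 and `b1` has -2, which is negative.
  rcases W.apply_a c g with ⟨ha1, -⟩ | ⟨ha1, ha2⟩
  · have := W.add_eq_zero ha1
    have := W.nonneg_of_prefers (b1 c g) (xPrime (φ.clause c (g + 2)))
      (by simp [Listed, prefBlocks]) (by simp [W.symm ha1, rank])
    omega
  · have := W.add_eq_zero ha1
    have := W.add_eq_zero ha2
    have := W.nonneg_of_prefers (a2 c g) (b2 c g) (by simp [Listed, prefBlocks])
      (by simp [ha2, rank])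
    have := W.nonneg_of_prefers (a1 c g) (yPrime (φ.clause c (g + 1)))
      (by simp [Listed, prefBlocks]) (by simp [ha1, rank])
    omega

/-! ### Level 3: the partners of `s0` and `t0` -/

theorem apply_s (W : φ.Certified μ β) (c : Fin φ.numClauses) (r : Fin 3) :
    μ (s c r) = t c r ∨ μ (s c r) = t0 c ∧ μ (t c r) = s0 c := by
  have h1 := W.listed (s c r) (by simp) (by simp)
  have h2 := W.listed (t c r) (by simp) (by simp)
  simp only [Listed, prefBlocks] at h1 h2
  simp at h1 h2
  rcases h1 with h1 | h1
  · exact Or.inl h1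
  · rcases h2 with h2 | h2
    · exact Or.inl (W.symm h2)
    · exact Or.inr ⟨h1, h2⟩

/-- If every `s_r` is matched to `t_r`, no `t_r` is preferred by `s_0` while `s_r` is preferred by
`t_0`. -/
theorem not_both_prefer (W : φ.Certified μ β) (c : Fin φ.numClauses) (r : Fin 3)
    (h : μ (s c r) = t c r) (h1 : φ.rank (s0 c) (t c r) < φ.rank (s0 c) (μ (s0 c)))
    (h2 : φ.rank (t0 c) (s c r) < φ.rank (t0 c) (μ (t0 c))) : False := by
  have l1 : φ.Listed (s0 c) (t c r) := φ.listed_symm (by simp [Listed, prefBlocks])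
  have l2 : φ.Listed (t0 c) (s c r) := φ.listed_symm (by simp [Listed, prefBlocks])
  have e1 := W.nonneg_of_prefers _ _ l1 (Or.inr h1)
  have e2 := W.nonneg_of_prefers _ _ l2 (Or.inr h2)
  have e3 := W.s0_eq c
  have e4 := W.t0_eq c
  have e5 := W.add_eq_zero h
  omega

/-- The lists of `s0` and `t0` run through the indices in opposite directions. If every `s` is
matched to its `t`, then for each index at most one of `s0`, `t0` may prefer its end of that edge,
and comparing positions leaves only these cases. -/
theorem apply_s0_t0_cases (W : φ.Certified μ β) (c : Fin φ.numClauses) :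
    (∃ r, μ (s0 c) = t c r ∧ μ (t0 c) = s c r) ∨
      μ (s0 c) = q0 c 0 ∧ (μ (t0 c) = p1 c 2 ∨ μ (t0 c) = p1 c 1) ∨
      μ (s0 c) = q0 c 1 ∧ μ (t0 c) = p1 c 2 := by
  by_cases hr : ∃ r, μ (s0 c) = t c r ∧ μ (t0 c) = s c r
  · exact Or.inl hr
  right
  have hs : ∀ r, μ (s c r) = t c r := fun r => (W.apply_s c r).resolve_right fun h =>
    hr ⟨r, W.symm h.2, W.symm h.1⟩
  have hs0 : ∀ r, μ (s0 c) ≠ t c r := fun r h => by simpa using W.inj h (hs r)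
  have ht0 : ∀ r, μ (t0 c) ≠ s c r := fun r h => by
    simpa using (W.symm h).symm.trans (hs r)
  have l1 := W.listed (s0 c) (by simp) (by simp)
  have l2 := W.listed (t0 c) (by simp) (by simp)
  have n := fun r => W.not_both_prefer c r (hs r)
  have n0 := n 0
  have n1 := n 1
  have n2 := n 2
  simp only [Listed, prefBlocks] at l1 l2
  simp [hs0, ht0] at l1 l2
  have l1' : μ (s0 c) = q0 c 0 ∨ μ (s0 c) = q0 c 1 ∨ φ.rank (s0 c) (μ (s0 c)) = 5 := by
    rcases l1 with h | h | ⟨i, h⟩ | ⟨d, g, h⟩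
    · exact Or.inl h
    · exact Or.inr (Or.inl h)
    all_goals
      rw [h]
      exact Or.inr (Or.inr rfl)
  have l2' : μ (t0 c) = p1 c 2 ∨ μ (t0 c) = p1 c 1 ∨ φ.rank (t0 c) (μ (t0 c)) = 5 := by
    rcases l2 with h | h | ⟨i, h⟩ | ⟨d, g, h⟩
    · exact Or.inl h
    · exact Or.inr (Or.inl h)
    all_goals
      rw [h]
      exact Or.inr (Or.inr rfl)
  clear l1 l2 n
  rcases l1' with h1 | h1 | h1
  · refine Or.inl ⟨h1, ?_⟩
    rw [h1] at n0
    rcases l2' with h2 | h2 | h2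
    · exact Or.inl h2
    · exact Or.inr h2
    · rw [h2] at n0
      simp [rank] at n0
  · refine Or.inr ⟨h1, ?_⟩
    rw [h1] at n0 n1
    rcases l2' with h2 | h2 | h2
    · exact h2
    · rw [h2] at n1
      simp [rank] at n1
    · rw [h2] at n0
      simp [rank] at n0
  · rw [h1] at n0 n1 n2
    exfalso
    rcases l2' with h2 | h2 | h2 <;> rw [h2] at n2 <;> simp [rank] at n2

/-! ### Level 2: the three states of a gadget -/

theorem apply_t0_ne_p2 (W : φ.Certified μ β) (c d : Fin φ.numClauses) (g : Fin 3) :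
    μ (t0 d) ≠ p2 c g := by
  intro h
  rcases W.apply_s0_t0_cases d with ⟨r, -, h'⟩ | ⟨-, h' | h'⟩ | ⟨-, h'⟩ <;> simp [h] at h'

theorem apply_p2 (W : φ.Certified μ β) (c : Fin φ.numClauses) (g : Fin 3) :
    μ (p2 c g) = q0 c g ∨ μ (p2 c g) = q1 c g ∨ μ (p2 c g) = q2 c g := by
  have h := W.listed (p2 c g) (by simp) (by simp)
  simp only [Listed, prefBlocks] at h
  simp at h
  rcases h with h | h | h | h | ⟨d, h⟩
  · exact Or.inl h
  · rcases W.apply_y (φ.clause c (g + 1)) with h' | h' <;>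
      simpa using (W.symm h).symm.trans h'
  · exact Or.inr (Or.inl h)
  · exact Or.inr (Or.inr h)
  · exact absurd (W.symm h) (W.apply_t0_ne_p2 c d g)

theorem apply_p0 (W : φ.Certified μ β) (c : Fin φ.numClauses) (g : Fin 3) :
    μ (p0 c g) = q0 c g ∨ μ (p0 c g) = q2 c g := by
  have h := W.listed (p0 c g) (by simp) (by simp)
  simpa [Listed, prefBlocks] using h

theorem apply_p1 (W : φ.Certified μ β) (c : Fin φ.numClauses) (g : Fin 3)
    (hg : μ (t0 c) ≠ p1 c g) : μ (p1 c g) = q1 c g ∨ μ (p1 c g) = q2 c g := by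
  have h := W.listed (p1 c g) (by simp) (by simp)
  simp only [Listed, prefBlocks] at h
  simp [W.apply_ne_z] at h
  rcases h with h | h | ⟨-, h⟩
  · exact Or.inl h
  · exact Or.inr h
  · exact absurd (W.symm h) hg

/-- A counting argument: if `s0` takes `q0` while `t0` does not take `p1`, the three p nodes of the
gadget must share the two remaining q nodes. -/
theorem apply_s0_ne_q0 (W : φ.Certified μ β) (c : Fin φ.numClauses) (g : Fin 3)
    (hg : μ (t0 c) ≠ p1 c g) : μ (s0 c) ≠ q0 c g := by
  intro h
  have h0 : μ (p0 c g) = q2 c g :=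
    (W.apply_p0 c g).resolve_left fun h' => by simpa using W.inj h h'
  have h1 : μ (p1 c g) = q1 c g :=
    (W.apply_p1 c g hg).resolve_right fun h' => by simpa using W.inj h0 h'
  rcases W.apply_p2 c g with h2 | h2 | h2
  · simpa using W.inj h h2
  · simpa using W.inj h1 h2
  · simpa using W.inj h0 h2

/-- In the other cases `s0` and `t0` enter different level 2 gadgets, and the counting argument
excludes the gadget entered by `s0`. -/
theorem exists_apply_s0_t0 (W : φ.Certified μ β) (c : Fin φ.numClauses) :
    ∃ r, μ (s0 c) = t c r ∧ μ (t0 c) = s c r := by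
  rcases W.apply_s0_t0_cases c with h | ⟨h, h'⟩ | ⟨h, h'⟩
  · exact h
  · refine absurd h (W.apply_s0_ne_q0 c 0 ?_)
    rcases h' with h' | h' <;> simp [h']
  · exact absurd h (W.apply_s0_ne_q0 c 1 (by simp [h']))

theorem apply_p (W : φ.Certified μ β) (c : Fin φ.numClauses) (g : Fin 3) :
    μ (p0 c g) = q0 c g ∧ μ (p1 c g) = q1 c g ∧ μ (p2 c g) = q2 c g ∨
      μ (p0 c g) = q2 c g ∧ μ (p1 c g) = q1 c g ∧ μ (p2 c g) = q0 c g ∨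
      μ (p0 c g) = q0 c g ∧ μ (p1 c g) = q2 c g ∧ μ (p2 c g) = q1 c g := by
  obtain ⟨r, -, hr⟩ := W.exists_apply_s0_t0 c
  have h01 : ∀ v, μ (p0 c g) = v → μ (p1 c g) = v → False := fun v h h' => by
    simpa using W.inj h h'
  have h02 : ∀ v, μ (p0 c g) = v → μ (p2 c g) = v → False := fun v h h' => by
    simpa using W.inj h h'
  have h12 : ∀ v, μ (p1 c g) = v → μ (p2 c g) = v → False := fun v h h' => by
    simpa using W.inj h h'
  rcases W.apply_p0 c g with h0 | h0 <;>
    rcases W.apply_p1 c g (by simp [hr]) with h1 | h1 <;>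
      rcases W.apply_p2 c g with h2 | h2 | h2
  all_goals first
    | exact (h01 _ h0 h1).elim
    | exact (h02 _ h0 h2).elim
    | exact (h12 _ h1 h2).elim
    | exact Or.inl ⟨h0, h1, h2⟩
    | exact Or.inr (Or.inl ⟨h0, h1, h2⟩)
    | exact Or.inr (Or.inr ⟨h0, h1, h2⟩)

/-- A level 2 gadget with a positive label forces one of its two literals to be true. -/
theorem exists_true_of_pos (W : φ.Certified μ β) (c : Fin φ.numClauses) (g : Fin 3)
    (h : 2 ≤ β (p1 c g) ∨ 2 ≤ β (q0 c g)) :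
    μ (x (φ.clause c (g + 1))) = yPrime (φ.clause c (g + 1)) ∨
      μ (x (φ.clause c (g + 2))) = yPrime (φ.clause c (g + 2)) := by
  have b0 := W.le_two (p0 c g)
  have b1 := W.le_two (q1 c g)
  rcases W.apply_p c g with ⟨h0, h1, h2⟩ | ⟨h0, h1, h2⟩ | ⟨h0, h1, h2⟩
  -- In the stable state the preferences of `p2` for `q1` and of `q2` for `p0` bound the sum of the
  -- labels of `p1` and `q0` by 0; both are nonnegative through z and z', so both vanish.
  · exfalso
    have e0 := W.add_eq_zero h0
    have e1 := W.add_eq_zero h1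
    have e2 := W.add_eq_zero h2
    have f1 := W.nonneg_of_prefers zPrime (q0 c g) (by simp [Listed, prefBlocks])
      (Or.inl W.apply_zPrime)
    have f2 := W.nonneg_of_prefers z (p1 c g) (by simp [Listed, prefBlocks]) (Or.inl W.apply_z)
    have f3 := W.z_eq
    have f4 := W.zPrime_eq
    have g1 := W.nonneg_of_prefers (p2 c g) (q1 c g) (by simp [Listed, prefBlocks])
      (by simp [h2, rank])
    have g2 := W.nonneg_of_prefers (q2 c g) (p0 c g) (by simp [Listed, prefBlocks])
      (by simp [W.symm h2, rank])
    omega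
  -- The edge `p0 q0` blocks, so `p0` has label 2 and its partner `q2` has -2; `q2` prefers its x
  -- node, which must therefore have label 2. The remaining state is analogous, with `p1 q1`
  -- blocking.
  · right
    have e0 := W.add_eq_zero h0
    have f := W.four_le_of_prefers (p0 c g) (q0 c g) (by simp [Listed, prefBlocks])
      (by simp [h0, rank]) (by simp [W.symm h2, rank])
    have f0 := W.le_two (q0 c g)
    have k := W.nonneg_of_prefers (q2 c g) (x (φ.clause c (g + 2))) (by simp [Listed, prefBlocks])
      (by simp [W.symm h0, rank])
    exact W.apply_x_eq_yPrime_of_pos (by omega)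
  · left
    have e2 := W.add_eq_zero h2
    have f := W.four_le_of_prefers (p1 c g) (q1 c g) (by simp [Listed, prefBlocks])
      (by simp [h1, rank]) (by simp [W.symm h2, rank])
    have f0 := W.le_two (p1 c g)
    have k := W.nonneg_of_prefers (p2 c g) (y (φ.clause c (g + 1))) (by simp [Listed, prefBlocks])
      (by simp [h2, rank])
    exact W.apply_x_eq_yPrime_of_pos (by omega)

/-- Level 3 makes two of the three level 2 gadgets of every clause carry a positive label. -/
theorem exists_pos_of_ne (W : φ.Certified μ β) (c : Fin φ.numClauses) :
    ∃ r : Fin 3, ∀ g, g ≠ r → 2 ≤ β (p1 c g) ∨ 2 ≤ β (q0 c g) := by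
  obtain ⟨r, hs, ht⟩ := W.exists_apply_s0_t0 c
  have e1 := W.s0_eq c
  have e2 := W.t0_eq c
  -- The blocks of `s` and `p1` alternate in the list of `t0`: rank 5 - 2g beats 4 - 2r exactly when
  -- g > r. Likewise 2g + 1 beats 2r for `s0` exactly when g < r.
  have hp : ∀ g, r < g → 2 ≤ β (p1 c g) := by
    intro g hg
    have hg0 : g ≠ 0 := by omega
    have := W.nonneg_of_prefers (t0 c) (p1 c g)
      (φ.listed_symm (by simp [Listed, prefBlocks, hg0]))
      (Or.inr (by rw [ht]; simp only [rank]; omega))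
    omega
  have hq : ∀ g, g < r → 2 ≤ β (q0 c g) := by
    intro g hg
    have hg2 : g ≠ 2 := by omega
    have := W.nonneg_of_prefers (s0 c) (q0 c g)
      (φ.listed_symm (by simp [Listed, prefBlocks, hg2]))
      (Or.inr (by rw [hs]; simp only [rank]; omega))
    omega
  refine ⟨r, fun g hg => ?_⟩
  rcases lt_or_gt_of_ne hg with h | h
  · exact Or.inr (hq g h)
  · exact Or.inl (hp g h)

/-! ### Reading off the assignment -/

theorem oneInThreeSat (W : φ.Certified μ β) : φ.OneInThreeSat := by
  refine ⟨fun i => decide (μ (x i) = yPrime i), fun c => ?_⟩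
  obtain ⟨r, hr⟩ := W.exists_pos_of_ne c
  have h1 := fun g hg => W.exists_true_of_pos c g (hr g hg)
  have h2 := W.not_both_true c
  simp only [decide_eq_true_eq]
  generalize hP : (fun j => μ (x (φ.clause c j)) = yPrime (φ.clause c j)) = P
  have hP' : ∀ j, (μ (x (φ.clause c j)) = yPrime (φ.clause c j)) = P j := fun j => by rw [← hP]
  simp only [hP'] at h1 h2 ⊢
  clear hP hP' hr
  -- One gadget other than r already supplies a true position; uniqueness comes from level 0, since
  -- any two distinct positions are g + 1 and g + 2 for the third index g.
  have k1 : ∃ j, P j := by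
    by_cases h : r = 0
    · rcases h1 1 (by simp [h]) with h | h <;> exact ⟨_, h⟩
    · rcases h1 0 (Ne.symm h) with h | h <;> exact ⟨_, h⟩
  obtain ⟨j, hj⟩ := k1
  refine ⟨j, hj, fun k hk => ?_⟩
  have h3 : ∀ g : Fin 3, k = g + 1 → j = g + 2 → False := fun g e e' =>
    h2 g (e ▸ hk) (e' ▸ hj)
  have h4 : ∀ g : Fin 3, k = g + 2 → j = g + 1 → False := fun g e e' =>
    h2 g (e' ▸ hj) (e ▸ hk)
  clear h1 h2 hj hk
  revert j k
  decide

end Certified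

end Formula

end PopularMatching

theorem mainTheorem9 (φ : PopularMatching.Formula) (tie : φ.GNode → φ.GNode → ℕ)
    (htie : ∀ u, Function.Injective (tie u)) :
    (∃ M : (φ.gadgetInstance tie htie).graph.Subgraph,
      (φ.gadgetInstance tie htie).IsPopularMatching M ∧
        M.verts = {PopularMatching.Node.z, PopularMatching.Node.zPrime}ᶜ) ↔
      φ.OneInThreeSat := by
  constructor
  · rintro ⟨M, hM, hverts⟩
    obtain ⟨μ, β, W⟩ := PopularMatching.Formula.exists_certified hM hverts
    exact W.oneInThreeSat
  · exact φ.exists_popular_of_oneInThreeSat tie htie
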